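/- Let $V\subseteq\mathbb{Z}^2$ be an infinite set that is connected in the square lattice $(\mathbb{Z}^2,\mathcal{E}^2)$ and whose complement is also infinite and connected, and let $E$ be the set of nearest-neighbour edges with both endpoints in $V$. Let $\Gamma=(e_i^*)_{i\in\mathbb{Z}}$ be a doubly infinite path without self-intersections in the dual lattice $\mathbb{Z}^2+(\tfrac12,\tfrac12)$ whose edges are dual to exactly the lattice edges $e_i$ having one endpoint in $V$ and one in $V^c$ (so that $(V,E)$ is one of the two components of the lattice with the edges $(e_i)$ removed), and let $v_i$ be the endpoint of $e_i$ in $V$. For $\omega=(\omega_e)_{e\in E}\in\Omega=[0,\infty)^E$ and a finite path $\gamma$ in $(V,E)$ (vertices may be repeated) put $\tau(\gamma)=\sum_{e\in\gamma}\omega_e$, counted with multiplicity, and let $\tau(x,y)$ be the infimum of $\tau(\gamma)$ over the paths $\gamma$ from $x$ to $y$ in $(V,E)$. A path $\gamma$ from $x$ to $y$ is a geodesic if $\tau(\gamma)=\tau(x,y)$. Let $\vec{E}=\{(x,y):\{x,y\}\in E\}$. For $n\in\mathbb{Z}$ define $\eta_n=\eta_n(\omega)\in\{0,1\}^{\vec{E}}$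 by $\eta_n((x,y))=1$ if $\{x,y\}$ lies in a geodesic from some vertex of $V$ to $v_n$ and $\tau(x,v_n)\ge\tau(y,v_n)$, and $\eta_n((x,y))=0$ otherwise. Let $\mathbb{G}_n$ be the directed graph on $V$ whose edges are the $e\in\vec{E}$ with $\eta_n(e)=1$. Let $\mathbb{P}$ be a probability measure on $\Omega$ with the product Borel $\sigma$-algebra such that for all $x,y\in V$, $\mathbb{P}$-almost surely there is a geodesic from $x$ to $y$. Then, with probability one, the following holds: there is $\eta\in\{0,1\}^{\vec{E}}$ such that $\eta_n(e)\to\eta(e)$ as $n\to\infty$ for every $e\in\vec{E}$, that is, $(\mathbb{G}_n)$ converges to the directed graph $\mathbb{G}$ with edge set $\{e\in\vec{E}:\eta(e)=1\}$; and each finite directed path in $\mathbb{G}$ is a geodesic (hence so is each infinite directed path, in the sense that all its finite subpaths are geodesics). -/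

import Mathlib

open Filter Topology MeasureTheory
open scoped NNReal

namespace FPP

/-- The square lattice `(ℤ², 𝓔²)` with nearest-neighbour edges. -/
def squareLattice : SimpleGraph (ℤ × ℤ) where
  Adj p q := |p.1 - q.1| + |p.2 - q.2| = 1
  symm := ⟨fun p q h => by rw [abs_sub_comm q.1, abs_sub_comm q.2]; exact h⟩
  loopless := ⟨fun p h => by simp at h⟩

/-- The graph `(V, E)`, where `E` consists of the lattice edges with both endpoints in `V`. -/
abbrev domainGraph (V : Set (ℤ × ℤ)) : SimpleGraph V := squareLattice.induce V

/-- The configuration space `Ω = [0, ∞)^E`; as a measurable space it carries the product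
Borel sigma-algebra. -/
abbrev Config (V : Set (ℤ × ℤ)) : Type := (domainGraph V).edgeSet → ℝ≥0

/-! ### The boundary of `V` as a doubly infinite dual path

The dual vertex `a + (1/2, 1/2)` is represented by the lattice point `a`. -/

/-- The lattice edge that is bisected by the dual edge with endpoints `a + (1/2, 1/2)` and
`b + (1/2, 1/2)`, where `a` and `b` are neighbours (maxima and minima are coordinatewise). -/
def primalEdge (a b : ℤ × ℤ) : Sym2 (ℤ × ℤ) := s(a ⊔ b, a ⊓ b + (1, 1))

/-- `primalEdge a b` is an edge of the lattice. -/
theorem primalEdge_mem {a b : ℤ × ℤ} (h : squareLattice.Adj a b) :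
    primalEdge a b ∈ squareLattice.edgeSet := by
  obtain ⟨a₁, a₂⟩ := a
  obtain ⟨b₁, b₂⟩ := b
  simp only [squareLattice] at h
  simp only [primalEdge, SimpleGraph.mem_edgeSet, squareLattice, Prod.mk_sup_mk,
    Prod.mk_inf_mk, Prod.mk_add_mk]
  grind

/-- `primalEdge a b` and the dual edge have the same midpoint. -/
theorem primalEdge_midpoint (a b : ℤ × ℤ) :
    (a ⊔ b) + (a ⊓ b + (1, 1)) = a + b + (1, 1) := by
  obtain ⟨a₁, a₂⟩ := a
  obtain ⟨b₁, b₂⟩ := b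
  simp only [Prod.mk_sup_mk, Prod.mk_inf_mk, Prod.mk_add_mk, Prod.mk.injEq]
  grind

/-- The edge boundary of `V`: the lattice edges with exactly one endpoint in `V`. -/
def edgeBoundary (V : Set (ℤ × ℤ)) : Set (Sym2 (ℤ × ℤ)) :=
  {e | ∃ x y, x ∈ V ∧ y ∉ V ∧ squareLattice.Adj x y ∧ e = s(x, y)}

/-- `Γ` is (the sequence of vertices of) a doubly infinite dual path without self-intersections
whose edges `e_i^*` are dual to exactly the edges of the boundary of `V`, so that `(V, E)` is
cut out of the lattice by the removal of the edges `e_i`. -/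
structure IsBoundaryPath (V : Set (ℤ × ℤ)) (Γ : ℤ → ℤ × ℤ) : Prop where
  injective : Function.Injective Γ
  adj : ∀ i, squareLattice.Adj (Γ i) (Γ (i + 1))
  range_eq : Set.range (fun i => primalEdge (Γ i) (Γ (i + 1))) = edgeBoundary V

/-! ### Passage times and geodesics -/

variable {V : Set (ℤ × ℤ)}

/-- The passage time `τ(γ)` of a finite path `γ` in `(V, E)`: the sum of the weights of the
edges that `γ` traverses. -/
noncomputable def pathTime (ω : Config V) {x y : V} (γ : (domainGraph V).Walk x y) : ℝ≥0 :=
  (γ.darts.map fun d => ω ⟨d.edge, d.edge_mem⟩).sum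

/-- The passage time `τ(x, y)`, the infimum of `τ(γ)` over the paths `γ` from `x` to `y`. -/
noncomputable def passageTime (ω : Config V) (x y : V) : ℝ≥0 :=
  ⨅ γ : (domainGraph V).Walk x y, pathTime ω γ

/-- `γ` is a geodesic. -/
def IsGeodesic (ω : Config V) {x y : V} (γ : (domainGraph V).Walk x y) : Prop :=
  pathTime ω γ = passageTime ω x y

/-- The measure `P` admits geodesics. -/
def AdmitsGeodesics (P : Measure (Config V)) : Prop :=
  ∀ x y : V, ∀ᵐ ω ∂P, ∃ γ : (domainGraph V).Walk x y, IsGeodesic ω γ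

/-! ### Geodesic graphs

A directed graph with vertex set `V` whose edges are directed edges of `(V, E)` is given by its
configuration in `{0, 1}^{directed edges}`; the directed edges are the darts of `(V, E)`. -/

open Classical in
/-- The configuration of the graph of geodesics to `z`: the directed edge `(x, y)` is present if
`{x, y}` is in a geodesic from some vertex to `z` and `τ(x, z) ≥ τ(y, z)`. -/
noncomputable def geodesicConfig (ω : Config V) (z : V) : (domainGraph V).Dart → Fin 2 :=
  fun d =>
    if (∃ (u : V) (γ : (domainGraph V).Walk u z), IsGeodesic ω γ ∧ d.edge ∈ γ.edges) ∧
        passageTime ω d.fst z ≥ passageTime ω d.snd z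
    then 1 else 0

/-- The path `γ` is a directed path in the directed graph with configuration `η`. -/
def IsDirectedPath (η : (domainGraph V).Dart → Fin 2) {x y : V}
    (γ : (domainGraph V).Walk x y) : Prop :=
  ∀ d ∈ γ.darts, η d = 1

end FPP

/-! When geodesics exist, a directed edge `(x, y)` belongs to the geodesic graph of `z` exactly when
`τ(x, z) = ω + τ(y, z)`, with `ω` its weight (`geodesicConfig_eq_one_iff`). Call it optimal for `z`.
Fix the edge and let the boundary target `v n` vary. If the edge is optimal for two targets,
planarity makes the geodesics from `y` to them meet the geodesics from `x` to an interlaced pair.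
Rerouting at the meeting point makes the edge optimal for a target of that pair
(`isOptimal_of_interlaced`). Optimality therefore cannot alternate forever, and each edge is
eventually present or eventually absent.

A finite directed path of the limit lies in the graph of a single `v n`, where optimality telescopes
and the triangle inequality makes the path a geodesic (`isGeodesic_of_isOptimal`).

The planar input, `exists_mem_support_of_interlaced`, uses a winding number modulo two: the parity
of crossings of a closed walk with a ray. -/

namespace FPP

open SimpleGraph

/-! ### Parity of the number of crossings with a horizontal ray -/

/-- The dart `d` crosses the horizontal ray that starts at the dual vertex `f + (1/2, 1/2)` and
goes to the right. -/
def CrossesRay (f : ℤ × ℤ) (d : squareLattice.Dart) : Prop :=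
  d.fst.1 = d.snd.1 ∧ f.1 < d.fst.1 ∧ min d.fst.2 d.snd.2 = f.2

theorem crossesRay_iff {f : ℤ × ℤ} {d : squareLattice.Dart} : CrossesRay f d ↔
    d.fst.1 = d.snd.1 ∧ f.1 < d.fst.1 ∧ min d.fst.2 d.snd.2 = f.2 := ⟨id, id⟩

open Classical in
/-- The parity of the number of crossings of a walk with the ray from `f + (1/2, 1/2)`. -/
noncomputable def rayParity {x y : ℤ × ℤ} (p : squareLattice.Walk x y) (f : ℤ × ℤ) : ZMod 2 :=
  (p.darts.map fun d => if CrossesRay f d then 1 else 0).sum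

open Classical in
/-- The parity of the number of times that a walk traverses the edge `e`. -/
noncomputable def edgeParity {x y : ℤ × ℤ} (p : squareLattice.Walk x y)
    (e : Sym2 (ℤ × ℤ)) : ZMod 2 :=
  (p.edges.map fun e' => if e' = e then 1 else 0).sum

theorem edgeParity_cons {x y z : ℤ × ℤ} (h : squareLattice.Adj x y)
    (p : squareLattice.Walk y z) (e : Sym2 (ℤ × ℤ)) [Decidable (s(x, y) = e)] :
    edgeParity (Walk.cons h p) e = (if s(x, y) = e then 1 else 0) + edgeParity p e := by
  simp only [edgeParity, Walk.edges_cons, List.map_cons, List.sum_cons]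
  congr

theorem edgeParity_append {x y z : ℤ × ℤ} (p : squareLattice.Walk x y)
    (q : squareLattice.Walk y z) (e : Sym2 (ℤ × ℤ)) :
    edgeParity (p.append q) e = edgeParity p e + edgeParity q e := by
  simp [edgeParity, Walk.edges_append]

theorem edgeParity_eq_zero {x y : ℤ × ℤ} {p : squareLattice.Walk x y} {e : Sym2 (ℤ × ℤ)}
    (h : e ∉ p.edges) : edgeParity p e = 0 := by
  refine List.sum_eq_zero fun t ht => ?_
  obtain ⟨e', he', rfl⟩ := List.mem_map.1 ht
  exact if_neg (ne_of_mem_of_not_mem he' h)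

/-- Telescoping along a walk modulo two. -/
theorem sum_darts_eq {x y : ℤ × ℤ} (p : squareLattice.Walk x y) (g : ℤ × ℤ → ZMod 2) :
    (p.darts.map fun d => g d.fst + g d.snd).sum = g x + g y := by
  induction p with
  | nil => simp [CharTwo.add_self_eq_zero]
  | @cons u v w h p ih =>
    simp only [Walk.darts_cons, List.map_cons, List.sum_cons, ih]
    linear_combination CharTwo.add_self_eq_zero (g v)

theorem primalEdge_comm (a b : ℤ × ℤ) : primalEdge a b = primalEdge b a := by
  simp only [primalEdge, sup_comm, inf_comm]

theorem primalEdge_right (f : ℤ × ℤ) :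
    primalEdge f (f.1 + 1, f.2) = s((f.1 + 1, f.2), (f.1 + 1, f.2 + 1)) := by
  obtain ⟨i, j⟩ := f
  simp [primalEdge]

theorem primalEdge_up (f : ℤ × ℤ) :
    primalEdge f (f.1, f.2 + 1) = s((f.1, f.2 + 1), (f.1 + 1, f.2 + 1)) := by
  obtain ⟨i, j⟩ := f
  simp [primalEdge]

theorem squareLattice_adj_cases {a b : ℤ × ℤ} (h : squareLattice.Adj a b) :
    b = (a.1 + 1, a.2) ∨ b = (a.1, a.2 + 1) ∨ a = (b.1 + 1, b.2) ∨ a = (b.1, b.2 + 1) := by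
  obtain ⟨a₁, a₂⟩ := a
  obtain ⟨b₁, b₂⟩ := b
  simp only [squareLattice, Prod.mk.injEq] at h ⊢
  grind

/-- The two rays differ by a single lattice edge, so the identity holds dart by dart. -/
theorem rayParity_add_right {x : ℤ × ℤ} (p : squareLattice.Walk x x) (f : ℤ × ℤ) :
    rayParity p f + rayParity p (f.1 + 1, f.2)
      = edgeParity p (primalEdge f (f.1 + 1, f.2)) := by
  classical
  rw [primalEdge_right]
  simp only [rayParity, edgeParity, Walk.edges, List.map_map]
  rw [← List.sum_map_add]
  congr 1
  refine List.map_congr_left fun d hd => ?_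
  clear hd
  obtain ⟨⟨⟨a, b⟩, c, d⟩, h⟩ := d
  obtain ⟨i, j⟩ := f
  have h' := squareLattice_adj_cases h
  simp only [crossesRay_iff, Function.comp, Dart.edge_mk, Sym2.eq_iff, Prod.mk.injEq] at h' ⊢
  split_ifs <;> first | rfl | (exfalso; omega)

/-- The lattice half-line between the two parallel rays is entered and left an even number of times
in total. This happens across either ray or through the edge at its left end. -/
theorem rayParity_add_up {x : ℤ × ℤ} (p : squareLattice.Walk x x) (f : ℤ × ℤ) :
    rayParity p f + rayParity p (f.1, f.2 + 1)
      = edgeParity p (primalEdge f (f.1, f.2 + 1)) := by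
  classical
  rw [primalEdge_up]
  have ht := sum_darts_eq p fun u => if f.1 < u.1 ∧ u.2 = f.2 + 1 then 1 else 0
  rw [CharTwo.add_self_eq_zero] at ht
  rw [← add_zero (edgeParity _ _), ← ht]
  simp only [rayParity, edgeParity, Walk.edges, List.map_map]
  rw [← List.sum_map_add, ← List.sum_map_add]
  congr 1
  refine List.map_congr_left fun d hd => ?_
  clear hd
  obtain ⟨⟨⟨a, b⟩, c, d⟩, h⟩ := d
  obtain ⟨i, j⟩ := f
  have h' := squareLattice_adj_cases h
  simp only [crossesRay_iff, Function.comp, Dart.edge_mk, Sym2.eq_iff, Prod.mk.injEq] at h' ⊢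
  split_ifs <;> first | rfl | (exfalso; omega)

/-- The ray parities of a closed walk at neighbouring dual vertices differ by the parity of the
number of times that the walk traverses the edge between them. -/
theorem rayParity_add {x : ℤ × ℤ} (p : squareLattice.Walk x x) {f g : ℤ × ℤ}
    (h : squareLattice.Adj f g) :
    rayParity p f + rayParity p g = edgeParity p (primalEdge f g) := by
  rcases squareLattice_adj_cases h with h | h | h | h
  · rw [h]; exact rayParity_add_right p f
  · rw [h]; exact rayParity_add_up p f
  · rw [add_comm, primalEdge_comm, h]; exact rayParity_add_right p g
  · rw [add_comm, primalEdge_comm, h]; exact rayParity_add_up p g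

theorem rayParity_eq_of_notMem {x : ℤ × ℤ} (p : squareLattice.Walk x x) {f g u : ℤ × ℤ}
    (h : squareLattice.Adj f g) (hu : u ∈ primalEdge f g) (hup : u ∉ p.support) :
    rayParity p f = rayParity p g := by
  refine CharTwo.add_eq_zero.1 ?_
  rw [rayParity_add p h]
  refine edgeParity_eq_zero fun he => hup ?_
  exact Walk.mem_support_of_mem_edges he hu

/-- The dual vertex `f + (1/2, 1/2)` is the centre of a face with corner `u`. -/
def IsCorner (f u : ℤ × ℤ) : Prop :=
  (f.1 = u.1 ∨ f.1 = u.1 - 1) ∧ (f.2 = u.2 ∨ f.2 = u.2 - 1)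

theorem isCorner_of_mem_primalEdge {f g u : ℤ × ℤ} (h : squareLattice.Adj f g)
    (hu : u ∈ primalEdge f g) : IsCorner f u := by
  obtain ⟨i, j⟩ := f
  obtain ⟨k, l⟩ := g
  obtain ⟨a, b⟩ := u
  rcases squareLattice_adj_cases h with h | h | h | h <;>
    simp only [Prod.mk.injEq] at h <;> obtain ⟨rfl, rfl⟩ := h <;>
    simp [primalEdge, IsCorner] at hu ⊢ <;> omega

/-- Consecutive faces around `u` are separated by edges at `u`, none of which the walk traverses. -/
theorem rayParity_eq_of_isCorner {x : ℤ × ℤ} (p : squareLattice.Walk x x) {f u : ℤ × ℤ}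
    (hf : IsCorner f u) (hup : u ∉ p.support) : rayParity p f = rayParity p u := by
  have hadj₁ (a b : ℤ) : squareLattice.Adj (a - 1, b) (a, b) := by simp [squareLattice]
  have hadj₂ (a b : ℤ) : squareLattice.Adj (a, b - 1) (a, b) := by simp [squareLattice]
  obtain ⟨a, b⟩ := u
  have h₁ : rayParity p (a - 1, b) = rayParity p (a, b) :=
    rayParity_eq_of_notMem p (hadj₁ a b) (by simp [primalEdge]) hup
  have h₂ : rayParity p (a, b - 1) = rayParity p (a, b) :=
    rayParity_eq_of_notMem p (hadj₂ a b) (by simp [primalEdge]) hup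
  have h₃ : rayParity p (a - 1, b - 1) = rayParity p (a, b - 1) :=
    rayParity_eq_of_notMem p (hadj₁ a (b - 1)) (by simp [primalEdge]) hup
  obtain ⟨i, j⟩ := f
  obtain ⟨h | h, h' | h'⟩ := hf <;> dsimp only at h h' <;> subst h h' <;> simp [h₁, h₂, h₃]

theorem rayParity_eq_of_walk {x : ℤ × ℤ} (p : squareLattice.Walk x x) {u w : ℤ × ℤ}
    (q : squareLattice.Walk u w) (h : ∀ z ∈ q.support, z ∉ p.support) :
    rayParity p u = rayParity p w := by
  induction q with
  | nil => rfl
  | @cons u v w huv q ih =>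
    rw [← ih fun z hz => h z (by simp [hz])]
    have hu : u ∉ p.support := h u (by simp)
    have hv : v ∉ p.support := h v (by simp)
    rcases squareLattice_adj_cases huv with e | e | e | e
    · exact rayParity_eq_of_isCorner p (by simp [e, IsCorner]) hv
    · exact rayParity_eq_of_isCorner p (by simp [e, IsCorner]) hv
    · exact (rayParity_eq_of_isCorner p (by simp [e, IsCorner]) hu).symm
    · exact (rayParity_eq_of_isCorner p (by simp [e, IsCorner]) hu).symm

/-! ### Crossing of walks in a domain bounded by a dual path -/

theorem primalEdge_injective {a b c d : ℤ × ℤ} (hab : squareLattice.Adj a b)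
    (hcd : squareLattice.Adj c d) (h : primalEdge a b = primalEdge c d) :
    a = c ∧ b = d ∨ a = d ∧ b = c := by
  obtain ⟨a₁, a₂⟩ := a
  obtain ⟨b₁, b₂⟩ := b
  obtain ⟨c₁, c₂⟩ := c
  obtain ⟨d₁, d₂⟩ := d
  rcases squareLattice_adj_cases hab with e | e | e | e <;>
    simp only [Prod.mk.injEq] at e <;> obtain ⟨rfl, rfl⟩ := e <;>
    rcases squareLattice_adj_cases hcd with e | e | e | e <;>
    simp only [Prod.mk.injEq] at e <;> obtain ⟨rfl, rfl⟩ := e <;>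
    simp [primalEdge] at h ⊢ <;> omega

theorem mem_support_map_induce {S : Set (ℤ × ℤ)} {x y : S}
    {p : (squareLattice.induce S).Walk x y} {z : ℤ × ℤ} :
    z ∈ (p.map (Embedding.induce S).toHom).support ↔ ∃ h : z ∈ S, ⟨z, h⟩ ∈ p.support := by
  rw [Walk.support_map, List.mem_map]
  constructor
  · rintro ⟨z, hz, rfl⟩
    exact ⟨z.2, hz⟩
  · rintro ⟨h, hz⟩
    exact ⟨_, hz, rfl⟩

namespace IsBoundaryPath

variable {V : Set (ℤ × ℤ)} {Γ : ℤ → ℤ × ℤ}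

theorem primalEdge_inj (hΓ : IsBoundaryPath V Γ) {i j : ℤ}
    (h : primalEdge (Γ i) (Γ (i + 1)) = primalEdge (Γ j) (Γ (j + 1))) : i = j := by
  rcases primalEdge_injective (hΓ.adj i) (hΓ.adj j) h with ⟨h, -⟩ | ⟨h, h'⟩
  · exact hΓ.injective h
  -- Opposite orientations would force both `i = j + 1` and `i + 1 = j`.
  · have := hΓ.injective h
    have := hΓ.injective h'
    omega

theorem exists_outer_endpoint (hΓ : IsBoundaryPath V Γ) {i : ℤ} {u : ℤ × ℤ} (hu : u ∈ V)
    (hi : u ∈ primalEdge (Γ i) (Γ (i + 1))) :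
    ∃ w, w ∉ V ∧ squareLattice.Adj u w ∧ primalEdge (Γ i) (Γ (i + 1)) = s(u, w) := by
  have hmem : primalEdge (Γ i) (Γ (i + 1)) ∈ edgeBoundary V := hΓ.range_eq ▸ ⟨i, rfl⟩
  obtain ⟨x, y, hx, hy, hxy, he⟩ := hmem
  rw [he, Sym2.mem_iff] at hi
  obtain rfl : u = x := hi.resolve_right fun h => hy (h ▸ hu)
  exact ⟨y, hy, hxy, he⟩

/-- A boundary edge is not an edge of a walk that stays on one side of the boundary. -/
theorem primalEdge_notMem_edges (hΓ : IsBoundaryPath V Γ) (i : ℤ) {S : Set (ℤ × ℤ)}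
    (hS : S = V ∨ S = Vᶜ) {x y : ℤ × ℤ} {p : squareLattice.Walk x y}
    (hp : ∀ z ∈ p.support, z ∈ S) : primalEdge (Γ i) (Γ (i + 1)) ∉ p.edges := by
  intro he
  have hmem : primalEdge (Γ i) (Γ (i + 1)) ∈ edgeBoundary V := hΓ.range_eq ▸ ⟨i, rfl⟩
  obtain ⟨u, w, hu, hw, -, h⟩ := hmem
  rw [h] at he
  have h₁ := hp u (p.fst_mem_support_of_mem_edges he)
  have h₂ := hp w (p.snd_mem_support_of_mem_edges he)
  rcases hS with rfl | rfl
  · exact hw h₂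
  · exact h₁ hu

/-- Walks in `V` between interlaced pairs of boundary vertices meet. -/
theorem exists_mem_support_of_interlaced (hΓ : IsBoundaryPath V Γ)
    (hVc : (squareLattice.induce Vᶜ).Connected) {v : ℤ → V}
    (hv : ∀ i, (v i : ℤ × ℤ) ∈ primalEdge (Γ i) (Γ (i + 1))) {a b c d : ℤ}
    (hab : a < b) (hbc : b < c) (hcd : c < d)
    (p : (domainGraph V).Walk (v a) (v c)) (q : (domainGraph V).Walk (v b) (v d)) :
    ∃ z, z ∈ p.support ∧ z ∈ q.support := by
  classical
  by_contra! hpq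
  obtain ⟨wa, hwa, hadja, hea⟩ := hΓ.exists_outer_endpoint (v a).2 (hv a)
  obtain ⟨wc, hwc, hadjc, hec⟩ := hΓ.exists_outer_endpoint (v c).2 (hv c)
  obtain ⟨r⟩ := hVc.preconnected ⟨wc, hwc⟩ ⟨wa, hwa⟩
  let P : squareLattice.Walk (v a : ℤ × ℤ) (v c) := p.map (Embedding.induce V).toHom
  let Q : squareLattice.Walk (v b : ℤ × ℤ) (v d) := q.map (Embedding.induce V).toHom
  let R : squareLattice.Walk wc wa := r.map (Embedding.induce Vᶜ).toHom
  have hP : ∀ z ∈ P.support, z ∈ V := by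
    intro z hz
    exact (mem_support_map_induce.1 hz).1
  have hR : ∀ z ∈ R.support, z ∈ Vᶜ := by
    intro z hz
    exact (mem_support_map_induce.1 hz).1
  -- Close `p` up through the complement: leave `V` by the boundary edge `c` and return by the
  -- boundary edge `a`.
  let L : squareLattice.Walk (v a : ℤ × ℤ) (v a) :=
    P.append (Walk.cons hadjc (R.append (Walk.cons hadja.symm Walk.nil)))
  have hQL : ∀ z ∈ Q.support, z ∉ L.support := by
    intro z hz hzL
    obtain ⟨hzV, hzq⟩ := mem_support_map_induce.1 hz
    have hzp : z ∉ P.support := fun h =>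
      hpq _ (mem_support_map_induce.1 h).2 hzq
    have hzL' : z ∈ L.support := hzL
    simp only [L, Walk.mem_support_append_iff, Walk.support_cons, List.mem_cons,
      Walk.support_nil, List.not_mem_nil, or_false] at hzL'
    rcases hzL' with h | h | h | h | h
    · exact hzp h
    · exact hzp (h ▸ P.end_mem_support)
    · exact hR _ h hzV
    · exact hwa (h ▸ hzV)
    · exact hzp (h ▸ P.start_mem_support)
  -- Along `Γ` the parity flips only at the two boundary edges that `L` traverses.
  have hstep (i : ℤ) : rayParity L (Γ i) + rayParity L (Γ (i + 1))
      = (if c = i then 1 else 0) + (if a = i then 1 else 0) := by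
    rw [rayParity_add L (hΓ.adj i)]
    simp only [L, edgeParity_append, edgeParity_cons]
    rw [edgeParity_eq_zero (hΓ.primalEdge_notMem_edges i (Or.inl rfl) hP),
      edgeParity_eq_zero (hΓ.primalEdge_notMem_edges i (Or.inr rfl) hR),
      edgeParity_eq_zero (p := Walk.nil) (by simp), ← hec, Sym2.eq_swap, ← hea]
    have hinj (j : ℤ) : primalEdge (Γ j) (Γ (j + 1)) = primalEdge (Γ i) (Γ (i + 1)) ↔ j = i :=
      ⟨hΓ.primalEdge_inj, fun h => h ▸ rfl⟩
    simp only [hinj, zero_add, add_zero]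
  have hconst (i : ℤ) (hic : c ≠ i) (hia : a ≠ i) :
      rayParity L (Γ (i + 1)) = rayParity L (Γ i) := by
    have := hstep i
    rw [if_neg hic, if_neg hia, add_zero] at this
    exact (CharTwo.add_eq_zero.1 this).symm
  have h₁ : rayParity L (Γ c) = rayParity L (Γ b) := by
    refine Int.leInduction (m := b) (motive := fun i _ => i ≤ c →
      rayParity L (Γ i) = rayParity L (Γ b)) (fun _ => rfl) (fun i hi ih hic => ?_) c hbc.le le_rfl
    rw [hconst i (by omega) (by omega), ih (by omega)]
  have h₂ : rayParity L (Γ d) = rayParity L (Γ (c + 1)) := by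
    refine Int.leInduction (m := c + 1) (motive := fun i _ =>
      rayParity L (Γ i) = rayParity L (Γ (c + 1))) rfl (fun i hi ih => ?_) d hcd
    rw [hconst i (by omega) (by omega), ih]
  -- As `q` avoids `L`, the parity agrees at both ends of `q`; yet between `b` and `d` it flips
  -- exactly once, at `c`.
  have h₃ : rayParity L (Γ b) = rayParity L (Γ d) := by
    rw [rayParity_eq_of_isCorner L (isCorner_of_mem_primalEdge (hΓ.adj b) (hv b))
        (hQL _ Q.start_mem_support),
      rayParity_eq_of_isCorner L (isCorner_of_mem_primalEdge (hΓ.adj d) (hv d))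
        (hQL _ Q.end_mem_support)]
    exact rayParity_eq_of_walk L Q hQL
  have h₄ := hstep c
  rw [h₁, h₃, h₂, if_pos rfl, if_neg (by omega), CharTwo.add_self_eq_zero, add_zero] at h₄
  exact zero_ne_one h₄

end IsBoundaryPath

/-! ### Geodesics -/

section Geodesics

variable {V : Set (ℤ × ℤ)} {ω : Config V} {x y z : V}

theorem pathTime_cons (h : (domainGraph V).Adj x y) (p : (domainGraph V).Walk y z) :
    pathTime ω (Walk.cons h p) = ω ⟨s(x, y), h⟩ + pathTime ω p := by
  simp [pathTime, Dart.edge]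

theorem pathTime_append (p : (domainGraph V).Walk x y) (q : (domainGraph V).Walk y z) :
    pathTime ω (p.append q) = pathTime ω p + pathTime ω q := by
  simp [pathTime, Walk.darts_append]

theorem passageTime_le (γ : (domainGraph V).Walk x y) : passageTime ω x y ≤ pathTime ω γ :=
  ciInf_le (OrderBot.bddBelow _) γ

theorem passageTime_le_add (hω : ∀ x y : V, ∃ γ : (domainGraph V).Walk x y, IsGeodesic ω γ)
    (x y z : V) : passageTime ω x z ≤ passageTime ω x y + passageTime ω y z := by
  obtain ⟨p, hp⟩ := hω x y
  obtain ⟨q, hq⟩ := hω y z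
  rw [← hp, ← hq, ← pathTime_append]
  exact passageTime_le _

theorem passageTime_le_edge_add
    (hω : ∀ x y : V, ∃ γ : (domainGraph V).Walk x y, IsGeodesic ω γ)
    (h : (domainGraph V).Adj x y) (z : V) :
    passageTime ω x z ≤ ω ⟨s(x, y), h⟩ + passageTime ω y z := by
  obtain ⟨q, hq⟩ := hω y z
  rw [← hq, ← pathTime_cons h]
  exact passageTime_le _

theorem IsGeodesic.eq_add_of_mem_support
    (hω : ∀ x y : V, ∃ γ : (domainGraph V).Walk x y, IsGeodesic ω γ)
    {γ : (domainGraph V).Walk x y} (hγ : IsGeodesic ω γ) (hz : z ∈ γ.support) :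
    passageTime ω x y = passageTime ω x z + passageTime ω z y := by
  classical
  refine le_antisymm (passageTime_le_add hω x z y) ?_
  rw [← hγ, ← γ.take_spec hz, pathTime_append]
  exact add_le_add (passageTime_le _) (passageTime_le _)

/-- The directed edge `d` is the first edge of a geodesic to `z`. -/
def IsOptimal (ω : Config V) (z : V) (d : (domainGraph V).Dart) : Prop :=
  passageTime ω d.fst z = ω ⟨d.edge, d.edge_mem⟩ + passageTime ω d.snd z

/-- Tails of geodesics are geodesics, since a shorter tail would shorten the whole path. -/
theorem IsGeodesic.isOptimal (hω : ∀ x y : V, ∃ γ : (domainGraph V).Walk x y, IsGeodesic ω γ)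
    {γ : (domainGraph V).Walk x z} (hγ : IsGeodesic ω γ) {d : (domainGraph V).Dart}
    (hd : d ∈ γ.darts) : IsOptimal ω z d := by
  induction γ with
  | nil => simp at hd
  | @cons u v w h p ih =>
    have h₁ : ω ⟨s(u, v), h⟩ + pathTime ω p = passageTime ω u w := by
      rw [← hγ, pathTime_cons]
    have h₂ := passageTime_le_edge_add hω h w
    have h₃ := passageTime_le (ω := ω) p
    have h₄ : IsGeodesic ω p := by
      rw [← h₁] at h₂
      exact le_antisymm (le_of_add_le_add_left h₂) h₃
    rw [Walk.darts_cons, List.mem_cons] at hd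
    rcases hd with rfl | hd
    · rw [h₄] at h₁
      exact h₁.symm
    · exact ih h₄ hd

theorem geodesicConfig_eq_one_iff
    (hω : ∀ x y : V, ∃ γ : (domainGraph V).Walk x y, IsGeodesic ω γ) (z : V)
    (d : (domainGraph V).Dart) : geodesicConfig ω z d = 1 ↔ IsOptimal ω z d := by
  have h₀ : geodesicConfig ω z d = 1 ↔
      (∃ (u : V) (γ : (domainGraph V).Walk u z), IsGeodesic ω γ ∧ d.edge ∈ γ.edges) ∧
        passageTime ω d.fst z ≥ passageTime ω d.snd z := by
    rw [geodesicConfig]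
    split_ifs with h
    · exact ⟨fun _ => h, fun _ => rfl⟩
    · exact ⟨fun h' => absurd h' zero_ne_one, fun h' => absurd h' h⟩
  rw [h₀]
  constructor
  · rintro ⟨⟨u, γ, hγ, hd⟩, hle⟩
    obtain ⟨d', hd', he⟩ := List.mem_map.1 hd
    have hopt := hγ.isOptimal hω hd'
    rcases dart_edge_eq_iff d' d |>.1 he with rfl | rfl
    · exact hopt
    · have he' : (⟨d.symm.edge, d.symm.edge_mem⟩ : (domainGraph V).edgeSet)
          = ⟨d.edge, d.edge_mem⟩ := Subtype.ext d.edge_symm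
      have h : passageTime ω d.snd z = ω ⟨d.edge, d.edge_mem⟩ + passageTime ω d.fst z := by
        rw [← he']; exact hopt
      -- The geodesic uses the edge backwards. The condition on passage times then forces weight
      -- zero, and both orientations are optimal.
      have hz : ω ⟨d.edge, d.edge_mem⟩ = 0 := by
        rw [h] at hle
        simpa using hle
      rw [hz, zero_add] at h
      rw [IsOptimal, hz, zero_add, h]
  · intro hopt
    obtain ⟨p, hp⟩ := hω d.snd z
    refine ⟨⟨d.fst, Walk.cons d.adj p, ?_, by simp [Dart.edge]⟩, ?_⟩
    · rw [IsGeodesic, pathTime_cons, hp]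
      exact hopt.symm
    · rw [hopt]
      exact le_add_self

theorem eq_pathTime_add (γ : (domainGraph V).Walk x y)
    (h : ∀ d ∈ γ.darts, IsOptimal ω z d) :
    passageTime ω x z = pathTime ω γ + passageTime ω y z := by
  induction γ with
  | nil => simp [pathTime]
  | @cons u v w huv p ih =>
    have h₁ : IsOptimal ω z ⟨(u, v), huv⟩ := h _ (by simp)
    rw [pathTime_cons, add_assoc, ← ih fun d hd => h d (by simp [hd])]
    exact h₁

/-- A path all of whose edges are optimal for one target is a geodesic. -/
theorem isGeodesic_of_isOptimal
    (hω : ∀ x y : V, ∃ γ : (domainGraph V).Walk x y, IsGeodesic ω γ)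
    (γ : (domainGraph V).Walk x y) (h : ∀ d ∈ γ.darts, IsOptimal ω z d) : IsGeodesic ω γ := by
  refine le_antisymm ?_ (passageTime_le γ)
  have := passageTime_le_add hω x y z
  rw [eq_pathTime_add γ h] at this
  exact le_of_add_le_add_right this

/-- If a geodesic that uses `d` meets, after `d`, a geodesic from the origin of `d` to `w`, then
`d` is optimal for `w`. -/
theorem IsOptimal.of_meet (hω : ∀ x y : V, ∃ γ : (domainGraph V).Walk x y, IsGeodesic ω γ)
    {d : (domainGraph V).Dart} {u w : V} (hd : IsOptimal ω u d)
    (h₁ : passageTime ω d.snd u = passageTime ω d.snd z + passageTime ω z u)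
    (h₂ : passageTime ω d.fst w = passageTime ω d.fst z + passageTime ω z w) :
    IsOptimal ω w d := by
  refine le_antisymm (passageTime_le_edge_add hω d.adj w) ?_
  have h₃ := passageTime_le_add hω d.fst z u
  rw [hd, h₁, ← add_assoc] at h₃
  -- Cancelling `τ(z, u)` shows that going through `d` costs no more than `τ(d.fst, z)`, so a
  -- geodesic to `w` through `z` may start with `d`.
  have h₄ := le_of_add_le_add_right h₃
  rw [h₂]
  calc _ ≤ ω ⟨d.edge, d.edge_mem⟩ + (passageTime ω d.snd z + passageTime ω z w) := by
        gcongr; exact passageTime_le_add hω _ _ _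
    _ ≤ _ := by rw [← add_assoc]; gcongr

theorem isOptimal_of_interlaced
    (hω : ∀ x y : V, ∃ γ : (domainGraph V).Walk x y, IsGeodesic ω γ)
    (hVc : (squareLattice.induce Vᶜ).Connected) {Γ : ℤ → ℤ × ℤ} (hΓ : IsBoundaryPath V Γ)
    {v : ℤ → V} (hv : ∀ i, (v i : ℤ × ℤ) ∈ primalEdge (Γ i) (Γ (i + 1)))
    (d : (domainGraph V).Dart) {n₁ m₁ n₂ m₂ : ℤ} (h₁ : n₁ < m₁) (h₂ : m₁ < n₂) (h₃ : n₂ < m₂)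
    (hn₁ : IsOptimal ω (v n₁) d) (hn₂ : IsOptimal ω (v n₂) d) :
    IsOptimal ω (v m₁) d ∨ IsOptimal ω (v m₂) d := by
  obtain ⟨γ₁, hγ₁⟩ := hω d.snd (v n₁)
  obtain ⟨γ₂, hγ₂⟩ := hω d.snd (v n₂)
  obtain ⟨δ₁, hδ₁⟩ := hω d.fst (v m₁)
  obtain ⟨δ₂, hδ₂⟩ := hω d.fst (v m₂)
  -- The two joined paths run through the head and the tail of `d`. Whichever halves meet, one
  -- target of each pair is linked through `z`.
  obtain ⟨z, hzp, hzq⟩ := hΓ.exists_mem_support_of_interlaced hVc hv h₁ h₂ h₃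
    (γ₁.reverse.append γ₂) (δ₁.reverse.append δ₂)
  simp only [Walk.mem_support_append_iff, Walk.support_reverse, List.mem_reverse] at hzp hzq
  have key : ∃ u, IsOptimal ω u d ∧
      passageTime ω d.snd u = passageTime ω d.snd z + passageTime ω z u := by
    rcases hzp with h | h
    · exact ⟨_, hn₁, hγ₁.eq_add_of_mem_support hω h⟩
    · exact ⟨_, hn₂, hγ₂.eq_add_of_mem_support hω h⟩
  obtain ⟨u, hu, hzu⟩ := key
  rcases hzq with h | h
  · exact Or.inl (hu.of_meet hω hzu (hδ₁.eq_add_of_mem_support hω h))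
  · exact Or.inr (hu.of_meet hω hzu (hδ₂.eq_add_of_mem_support hω h))

end Geodesics

/-- A predicate on the integers that changes only finitely often is eventually constant. -/
theorem eventually_or_eventually_not_of_interlaced {p : ℤ → Prop}
    (h : ∀ n₁ m₁ n₂ m₂, n₁ < m₁ → m₁ < n₂ → n₂ < m₂ → p n₁ → p n₂ → p m₁ ∨ p m₂) :
    (∀ᶠ n in atTop, p n) ∨ ∀ᶠ n in atTop, ¬ p n := by
  by_contra! hc
  obtain ⟨hf, ht⟩ := hc
  obtain ⟨n₁, -, hn₁⟩ := (frequently_atTop'.1 ht) 0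
  obtain ⟨m₁, h₁, hm₁⟩ := (frequently_atTop'.1 hf) n₁
  obtain ⟨n₂, h₂, hn₂⟩ := (frequently_atTop'.1 ht) m₁
  obtain ⟨m₂, h₃, hm₂⟩ := (frequently_atTop'.1 hf) n₂
  exact (h n₁ m₁ n₂ m₂ h₁ h₂ h₃ hn₁ hn₂).elim hm₁ hm₂

end FPP

/-- `V` is an infinite connected set with infinite connected complement, `Γ` parametrizes its
boundary, and `v i` is the endpoint in `V` of the `i`-th boundary edge. -/
theorem theorem2 (V : Set (ℤ × ℤ)) (hV : V.Infinite)
    (hVconn : (FPP.squareLattice.induce V).Connected)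
    (hVc : Vᶜ.Infinite) (hVcconn : (FPP.squareLattice.induce Vᶜ).Connected)
    (Γ : ℤ → ℤ × ℤ) (hΓ : FPP.IsBoundaryPath V Γ)
    (v : ℤ → V) (hv : ∀ i, (v i : ℤ × ℤ) ∈ FPP.primalEdge (Γ i) (Γ (i + 1)))
    (P : Measure (FPP.Config V)) [IsProbabilityMeasure P] (hP : FPP.AdmitsGeodesics P) :
    ∀ᵐ ω ∂P, ∃ η : (FPP.domainGraph V).Dart → Fin 2,
      (∀ d, Tendsto (fun n : ℤ => FPP.geodesicConfig ω (v n) d) atTop (𝓝 (η d))) ∧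
      ∀ (x y : V) (γ : (FPP.domainGraph V).Walk x y),
        FPP.IsDirectedPath η γ → FPP.IsGeodesic ω γ := by
  -- Countability of `V` gives one null set for all pairs of vertices.
  have hall : ∀ᵐ ω ∂P, ∀ x y : V, ∃ γ : (FPP.domainGraph V).Walk x y, FPP.IsGeodesic ω γ :=
    ae_all_iff.2 fun x => ae_all_iff.2 fun y => hP x y
  filter_upwards [hall] with ω hω
  have hlim (d : (FPP.domainGraph V).Dart) :
      ∃ a : Fin 2, ∀ᶠ n : ℤ in atTop, FPP.geodesicConfig ω (v n) d = a := by
    rcases FPP.eventually_or_eventually_not_of_interlaced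
      (p := fun n => FPP.IsOptimal ω (v n) d) (fun n₁ m₁ n₂ m₂ h₁ h₂ h₃ hn₁ hn₂ =>
        FPP.isOptimal_of_interlaced hω hVcconn hΓ hv d h₁ h₂ h₃ hn₁ hn₂) with h | h
    · exact ⟨1, h.mono fun n hn => (FPP.geodesicConfig_eq_one_iff hω _ d).2 hn⟩
    · refine ⟨0, h.mono fun n hn => ?_⟩
      rw [← FPP.geodesicConfig_eq_one_iff hω] at hn
      omega
  choose η hη using hlim
  refine ⟨η, fun d => tendsto_nhds_of_eventually_eq (hη d), fun x y γ hγ => ?_⟩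
  -- The path has finitely many edges, so one `n` serves them all.
  have hev : ∀ᶠ n : ℤ in atTop, ∀ d ∈ γ.darts, FPP.IsOptimal ω (v n) d := by
    have : ∀ᶠ n : ℤ in atTop, ∀ d ∈ {d | d ∈ γ.darts}, FPP.IsOptimal ω (v n) d := by
      refine (eventually_all_finite (List.finite_toSet γ.darts)).2 fun d hd => ?_
      filter_upwards [hη d] with n hn
      exact (FPP.geodesicConfig_eq_one_iff hω _ d).1 (hn.trans (hγ d hd))
    exact this
  obtain ⟨n, hn⟩ := hev.exists
  exact FPP.isGeodesic_of_isOptimal hω γ hn
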